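/- Let $K$ be a field of characteristic zero and let $n, r$ be integers with $2<r<n$. Let $E$ be the edge set of the complete graph $K_n$ on $\{1,\dots,n\}$, and let $M_{K_n}^r$ be the truncation to rank $r$ of the graphic matroid of $K_n$, that is, the matroid on $E$ whose bases are the $r$-element subsets of edge sets of spanning trees of $K_n$ (equivalently, the edge sets of the forests in $K_n$ with exactly $r$ edges). Let $$\Phi=\sum_{B}\ \prod_{e\in B}x_e\in K[x_e\mid e\in E]$$ be its basis generating function, where $B$ runs over the bases of $M_{K_n}^r$, and let $\operatorname{Ann}(\Phi)$ be the homogeneous ideal of all $P\in K[x_e\mid e\in E]$ with $P\bigl((\partial/\partial x_e)_{e\in E}\bigr)\Phi=0$. Consider the graded algebra $A=K[x_e\mid e\in E]/\operatorname{Ann}(\Phi)=\bigoplus_{k=0}^{r}A_k$, where $A_k$ is the image of the space of homogeneous polynomials of degree $k$. Let $L=\sum_{e\in E}x_e$. Then multiplication by $L^{r-2}$ maps $A_1$ bijectively onto $A_{r-1}$. -/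

import Mathlib

open MvPolynomial

noncomputable section

/-! ### Graphic matroids and truncation -/

/-- Augmentation property of forests on a finite vertex set. -/
theorem forest_augmentation {V : Type*} [Finite V] {I J : Set (Sym2 V)}
    (hJd : ∀ e ∈ J, ¬ e.IsDiag)
    (hI : (SimpleGraph.fromEdgeSet I).IsAcyclic) (hJ : (SimpleGraph.fromEdgeSet J).IsAcyclic)
    (hlt : I.ncard < J.ncard) :
    ∃ e ∈ J, e ∉ I ∧ (SimpleGraph.fromEdgeSet (insert e I)).IsAcyclic := by
  classical
  by_contra! hno
  have : Fintype V := Fintype.ofFinite V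
  have hJne : J.Nonempty := by
    rw [← Set.ncard_pos]
    lia
  obtain ⟨e₀, he₀⟩ := hJne
  have : Nonempty V := by
    induction e₀ with
    | h u v => exact ⟨u⟩
  -- endpoints of edges of `J` are joined inside `I`
  have hreach : ∀ u v : V, s(u, v) ∈ J → (SimpleGraph.fromEdgeSet I).Reachable u v := by
    intro u v huv
    by_contra hnr
    have hnotin : s(u, v) ∉ I := fun h => hnr <| SimpleGraph.Adj.reachable <| by
      rw [SimpleGraph.fromEdgeSet_adj]
      exact ⟨h, fun h' => hJd _ huv (by simp [h'])⟩
    refine hno _ huv hnotin ?_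
    have h := SimpleGraph.IsAcyclic.sup_edge_of_not_reachable hnr hI
    rwa [SimpleGraph.edge, ← SimpleGraph.fromEdgeSet_union, Set.union_singleton] at h
  -- extend `J` to a spanning tree
  obtain ⟨T, hJT, hTmax⟩ :=
    SimpleGraph.exists_maximal_isAcyclic_of_le_isAcyclic (G := ⊤) le_top hJ
  have hT : T.IsTree :=
    (SimpleGraph.connected_top.maximal_le_isAcyclic_iff_isTree le_top).1 hTmax
  have hJsub : J ⊆ T.edgeSet := by
    have := SimpleGraph.edgeSet_mono hJT
    rw [SimpleGraph.edgeSet_fromEdgeSet] at this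
    exact fun e he => this ⟨he, by simpa using hJd e he⟩
  have hcard : T.edgeSet.ncard + 1 = Fintype.card V := by
    rw [← hT.card_edgeFinset, Set.ncard_eq_toFinset_card', SimpleGraph.edgeFinset]
  set D : Set (Sym2 V) := T.edgeSet \ J with hD
  have hsum : D.ncard + J.ncard = T.edgeSet.ncard := Set.ncard_sdiff_add_ncard_of_subset hJsub
  have hconn : (SimpleGraph.fromEdgeSet (I ∪ D)).Connected := by
    refine ⟨fun u v => ?_⟩
    obtain ⟨p⟩ := hT.connected.preconnected u v
    induction p with
    | nil => exact SimpleGraph.Reachable.refl _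
    | @cons a b c hab _ ih =>
      refine SimpleGraph.Reachable.trans ?_ ih
      by_cases hmem : s(a, b) ∈ J
      · exact (hreach a b hmem).mono (SimpleGraph.fromEdgeSet_mono Set.subset_union_left)
      · refine SimpleGraph.Adj.reachable ?_
        rw [SimpleGraph.fromEdgeSet_adj]
        exact ⟨Or.inr ⟨hab, hmem⟩, hab.ne⟩
  have h1 := hconn.card_vert_le_card_edgeSet_add_one
  have h2 : (SimpleGraph.fromEdgeSet (I ∪ D)).edgeSet.ncard ≤ (I ∪ D).ncard := by
    refine Set.ncard_le_ncard ?_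
    rw [SimpleGraph.edgeSet_fromEdgeSet]
    exact Set.sdiff_subset
  have h3 := Set.ncard_union_le I D
  rw [Nat.card_coe_set_eq, Nat.card_eq_fintype_card] at h1
  lia

/-- The graphic matroid of a simple graph `G` on a finite vertex set: the ground set is the edge
set of `G`, and a set of edges is independent iff it is the edge set of a forest.  If `G` is
connected, the bases are exactly the edge sets of the spanning trees of `G`. -/
def graphicMatroid {V : Type*} [Finite V] (G : SimpleGraph V) : Matroid (Sym2 V) :=
  (IndepMatroid.ofFinite (E := G.edgeSet) (Set.toFinite _)
    (fun I => I ⊆ G.edgeSet ∧ (SimpleGraph.fromEdgeSet I).IsAcyclic)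
    ⟨Set.empty_subset _, by
      rw [SimpleGraph.fromEdgeSet_empty]
      exact SimpleGraph.isAcyclic_bot⟩
    (fun _ _ hJ hIJ =>
      ⟨hIJ.trans hJ.1, hJ.2.anti (SimpleGraph.fromEdgeSet_mono hIJ)⟩)
    (fun _ _ hI hJ hlt => by
      obtain ⟨e, heJ, heI, h⟩ := forest_augmentation
        (fun e he => G.not_isDiag_of_mem_edgeSet (hJ.1 he)) hI.2 hJ.2 hlt
      exact ⟨e, heJ, heI, Set.insert_subset (hJ.1 heJ) hI.1, h⟩)
    (fun _ hI => hI.1)).matroid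

/-- The truncation of a matroid `M` to rank `r`: the independent sets are the independent sets of
`M` with at most `r` elements.  If `r` is at most the rank of `M`, the bases are exactly the
`r`-element subsets of bases of `M`. -/
def truncatedMatroid {α : Type*} (M : Matroid α) (r : ℕ) : Matroid α :=
  (IndepMatroid.ofBddAugment M.E (fun I => M.Indep I ∧ I.encard ≤ r)
    ⟨M.empty_indep, by simp⟩
    (fun _ _ hJ hIJ => ⟨hJ.1.subset hIJ, (Set.encard_le_encard hIJ).trans hJ.2⟩)
    (fun I J hI hJ hlt => by
      obtain ⟨e, he, h⟩ := hI.1.augment hJ.1 hlt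
      refine ⟨e, he.1, he.2, h, ?_⟩
      rw [Set.encard_insert_of_notMem he.2]
      exact (Order.add_one_le_of_lt hlt).trans hJ.2)
    ⟨r, fun _ hI => hI.2⟩
    (fun _ hI => hI.1.subset_ground)).matroid

/-! ### The algebra of a matroid -/

/-- The basis generating function `∑_B ∏_{e ∈ B} x_e` of a finite matroid, the sum running over
the bases `B`; the variables are indexed by the ground set. -/
def basisGenFun (K : Type*) [Field K] {α : Type*} (M : Matroid α) [M.Finite] :
    MvPolynomial M.E K :=
  ∑ᶠ B : {B : Finset M.E // M.IsBase (Subtype.val '' (B : Set M.E))}, ∏ e ∈ B.1, X e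

/-- The partial derivative `∂/∂x_i` as a `K`-linear endomorphism of the polynomial ring. -/
def partialEnd (K : Type*) [Field K] {σ : Type*} (i : σ) : Module.End K (MvPolynomial σ K) :=
  (pderiv i : Derivation K (MvPolynomial σ K) (MvPolynomial σ K))

theorem partialEnd_comm (K : Type*) [Field K] {σ : Type*} (i j : σ) :
    partialEnd K i * partialEnd K j = partialEnd K j * partialEnd K i := by
  have h : ⁅(pderiv i : Derivation K (MvPolynomial σ K) (MvPolynomial σ K)),
      (pderiv j : Derivation K (MvPolynomial σ K) (MvPolynomial σ K))⁆ = 0 := by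
    classical
    refine MvPolynomial.derivation_ext fun k => ?_
    simp [Derivation.commutator_apply, pderiv_X, Pi.single_apply, apply_ite]
  refine LinearMap.ext fun p => ?_
  have := DFunLike.congr_fun h p
  rw [Derivation.commutator_apply] at this
  exact sub_eq_zero.1 this

/-- The substitution `P ↦ P(∂/∂x)`, as a `K`-algebra homomorphism from polynomials to
differential operators with constant coefficients; it sends the variable `x_i` to `∂/∂x_i`. -/
def diffOp (K : Type*) [Field K] (σ : Type*) :
    MvPolynomial σ K →ₐ[K] Module.End K (MvPolynomial σ K) :=
  letI : CommSemiring (Algebra.adjoin K (Set.range (partialEnd K (σ := σ)))) :=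
    { Subalgebra.toSemiring _ with
      mul_comm := (Algebra.isMulCommutative_adjoin K (by
        rintro _ ⟨i, rfl⟩ _ ⟨j, rfl⟩
        exact partialEnd_comm K i j)).is_comm.comm }
  (Algebra.adjoin K (Set.range (partialEnd K (σ := σ)))).val.comp
    (aeval (S₁ := Algebra.adjoin K (Set.range (partialEnd K (σ := σ)))) fun i => ⟨partialEnd K i, Algebra.subset_adjoin ⟨i, rfl⟩⟩)

theorem diffOp_X (K : Type*) [Field K] {σ : Type*} (i : σ) :
    diffOp K σ (X i) = partialEnd K i := by
  simp [diffOp]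

/-- `Ann(Φ)`, the ideal of all polynomials `P` with `P(∂/∂x) Φ = 0`. -/
def annIdeal {K : Type*} [Field K] {σ : Type*} (Φ : MvPolynomial σ K) :
    Ideal (MvPolynomial σ K) where
  carrier := {P | diffOp K σ P Φ = 0}
  zero_mem' := by simp
  add_mem' := by
    intro P Q hP hQ
    simp only [Set.mem_ofPred_eq] at hP hQ ⊢
    simp [hP, hQ]
  smul_mem' := by
    intro P Q hQ
    simp only [Set.mem_ofPred_eq] at hQ ⊢
    simp [hQ]

/-- The algebra `A_M = K[x_e | e ∈ E] / Ann(Φ_M)` of a finite matroid `M` with ground set `E`. -/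
abbrev MatroidAlgebra (K : Type*) [Field K] {α : Type*} (M : Matroid α) [M.Finite] : Type _ :=
  MvPolynomial M.E K ⧸ annIdeal (basisGenFun K M)

/-- The homogeneous component of degree `k` of `A_M`: the classes of the homogeneous
polynomials of degree `k`. -/
def MatroidAlgebra.component (K : Type*) [Field K] {α : Type*} (M : Matroid α) [M.Finite]
    (k : ℕ) : Submodule K (MatroidAlgebra K M) :=
  (homogeneousSubmodule M.E K k).map
    (Ideal.Quotient.mkₐ K (annIdeal (basisGenFun K M))).toLinearMap

/-- The class in `A_M` of the sum of all the variables. -/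
def MatroidAlgebra.sumVars (K : Type*) [Field K] {α : Type*} (M : Matroid α) [M.Finite] :
    MatroidAlgebra K M :=
  Ideal.Quotient.mk _ (∑ᶠ e : M.E, X e)

/-- The truncation to rank `r` of the graphic matroid of the complete graph `K_n`. -/
def truncatedComplete (n r : ℕ) : Matroid (Sym2 (Fin n)) :=
  truncatedMatroid (graphicMatroid (⊤ : SimpleGraph (Fin n))) r

instance truncatedComplete_finite (n r : ℕ) : (truncatedComplete n r).Finite :=
  ⟨Set.toFinite _⟩

end

/-! Let `H` be the Hessian of `Φ` at the all-ones point. A class of degree `r - 1` is determined by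
the linear form it produces from `Φ`, and by Euler's identity the `i`-th partial derivative of the
form produced by `L ^ (r - 2) * ∑ c_j x_j` is `(r - 2)!` times `(H c)_i`. Hence the theorem follows
once `det H ≠ 0` (`bijOn_sum_X_pow_mul`). The entries of `H` count the bases through two distinct
elements, so the determinant is an integer and it suffices to work over `ℝ`. Nonsingularity holds
for every simple matroid of rank at least two.

Over `ℝ`, consider the count matrices `H_S` of the contractions by independent sets `S`. In corank
two, `H_S` is the adjacency matrix of a complete multipartite graph on the nonloops, whose parts are
the parallel classes; it visibly satisfies a reverse Cauchy–Schwarz inequality with respect to `1`.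
A trickle-down argument (`Matrix.ReverseCauchySchwarz.of_local`) carries the inequality from all
`H_{S ∪ {k}}` to `H_S`.

If `H_S v = 0`, the equality case gives `H_{S ∪ {k}} v = 0` for every admissible `k`
(`Matrix.mulVec_eq_zero_of_local`). Descending to corank two shows that `v` sums to zero over each
parallel class there; climbing back up, flat by flat, gives the same over every `S`
(`sum_parallel_class_eq_zero_of_mulVec`). For `S = ∅` in a simple matroid the classes are single
points, so `v = 0`. -/

/-! ### Matrices with a reverse Cauchy–Schwarz inequality -/

section ReverseCauchySchwarz

open Matrix

variable {β : Type*} [Fintype β]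

/-- The reverse Cauchy–Schwarz inequality of a quadratic form with respect to the all-ones
vector. -/
def Matrix.ReverseCauchySchwarz (H : Matrix β β ℝ) : Prop :=
  ∀ v : β → ℝ, (v ⬝ᵥ H *ᵥ v) * (1 ⬝ᵥ H *ᵥ 1) ≤ (1 ⬝ᵥ H *ᵥ v) ^ 2

theorem Matrix.IsSymm.dotProduct_mulVec_comm {H : Matrix β β ℝ} (hH : H.IsSymm)
    (v w : β → ℝ) : v ⬝ᵥ H *ᵥ w = w ⬝ᵥ H *ᵥ v := by
  rw [dotProduct_mulVec, ← mulVec_transpose, hH.eq, dotProduct_comm]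

theorem Matrix.IsSymm.quadratic_add_smul {H : Matrix β β ℝ} (hH : H.IsSymm)
    (v w : β → ℝ) (t : ℝ) :
    (v + t • w) ⬝ᵥ H *ᵥ (v + t • w) =
      v ⬝ᵥ H *ᵥ v + 2 * t * (w ⬝ᵥ H *ᵥ v) + t ^ 2 * (w ⬝ᵥ H *ᵥ w) := by
  simp only [mulVec_add, mulVec_smul, dotProduct_add, add_dotProduct, dotProduct_smul,
    smul_dotProduct, smul_eq_mul, hH.dotProduct_mulVec_comm v w]
  ring

/-- It suffices that every vector has a nonpositive translate along the all-ones vector. -/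
theorem Matrix.ReverseCauchySchwarz.of_exists {H : Matrix β β ℝ} (hH : H.IsSymm)
    (h0 : 0 ≤ 1 ⬝ᵥ H *ᵥ 1)
    (h : ∀ v : β → ℝ, ∃ t : ℝ, (v + t • 1) ⬝ᵥ H *ᵥ (v + t • 1) ≤ 0) :
    H.ReverseCauchySchwarz := by
  intro v
  obtain ⟨t, ht⟩ := h v
  rw [hH.quadratic_add_smul] at ht
  have := mul_nonpos_of_nonneg_of_nonpos h0 ht
  -- Complete the square in `t` after multiplying the quadratic by its leading coefficient.
  nlinarith [sq_nonneg (t * (1 ⬝ᵥ H *ᵥ 1) + 1 ⬝ᵥ H *ᵥ v)]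

/-- Equality in the reverse Cauchy–Schwarz inequality. -/
theorem Matrix.ReverseCauchySchwarz.mulVec_eq_zero {H : Matrix β β ℝ}
    (hR : H.ReverseCauchySchwarz) (hH : H.IsSymm) (h1 : 0 < 1 ⬝ᵥ H *ᵥ 1) {v : β → ℝ}
    (hv1 : 1 ⬝ᵥ H *ᵥ v = 0) (hv : v ⬝ᵥ H *ᵥ v = 0) : H *ᵥ v = 0 := by
  set w := H *ᵥ v with hw
  -- Perturb `v` in the direction `w = H v`: the linear term in `t` is nonnegative for `t > 0`, and
  -- the inequality forces it to vanish.
  have key : ∀ t : ℝ, 2 * t * ((w ⬝ᵥ w) * (1 ⬝ᵥ H *ᵥ 1)) +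
      t ^ 2 * ((w ⬝ᵥ H *ᵥ w) * (1 ⬝ᵥ H *ᵥ 1) - (1 ⬝ᵥ H *ᵥ w) ^ 2) ≤ 0 := by
    intro t
    have := hR (v + t • w)
    rw [hH.quadratic_add_smul, ← hw, hv, mulVec_add, dotProduct_add, ← hw, hv1,
      mulVec_smul, dotProduct_smul, smul_eq_mul] at this
    nlinarith
  set b := (w ⬝ᵥ w) * (1 ⬝ᵥ H *ᵥ 1)
  set c := (w ⬝ᵥ H *ᵥ w) * (1 ⬝ᵥ H *ᵥ 1) - (1 ⬝ᵥ H *ᵥ w) ^ 2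
  have hb : 0 ≤ b :=
    mul_nonneg (Finset.sum_nonneg fun i _ => mul_self_nonneg (w i)) h1.le
  have hb0 : b = 0 := by
    by_contra hne
    have hb' : 0 < b := lt_of_le_of_ne hb (Ne.symm hne)
    -- With this `t` one has `t * |c| ≤ b`, so `2 * t * b + t ^ 2 * c ≥ t * b > 0`, a contradiction.
    have h := key (b / (|c| + b))
    have hs : 0 < |c| + b := by positivity
    have h2 : b / (|c| + b) * (|c| + b) = b := div_mul_cancel₀ _ hs.ne'
    set t := b / (|c| + b)
    have ht : 0 < t := by positivity
    have hc : -|c| ≤ c := neg_abs_le c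
    nlinarith [mul_pos ht hb', mul_pos ht ht, mul_le_mul_of_nonneg_left hc (mul_pos ht ht).le]
  have : w ⬝ᵥ w = 0 := by
    rcases mul_eq_zero.1 hb0 with h | h
    · exact h
    · exact absurd h h1.ne'
  exact dotProduct_self_eq_zero.1 this

theorem eq_zero_of_one_dotProduct_mulVec_one_nonpos {H : Matrix β β ℝ} (hn : ∀ i j, 0 ≤ H i j)
    (h : 1 ⬝ᵥ H *ᵥ 1 ≤ 0) : H = 0 := by
  have h' : ∑ i, ∑ j, H i j ≤ 0 := by
    simpa [dotProduct, mulVec] using h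
  have h0 : ∑ i, ∑ j, H i j = 0 :=
    le_antisymm h' (Finset.sum_nonneg fun i _ => Finset.sum_nonneg fun j _ => hn i j)
  ext i j
  have h1 := (Finset.sum_eq_zero_iff_of_nonneg fun i _ => Finset.sum_nonneg fun j _ => hn i j).1
    h0 i (Finset.mem_univ i)
  exact (Finset.sum_eq_zero_iff_of_nonneg fun j _ => hn i j).1 h1 j (Finset.mem_univ j)

/-- The Laplacian identity of the weighted graph `H`; it detects vectors that are constant along
edges. -/
theorem sum_mul_sub_sq {H : Matrix β β ℝ} (hH : H.IsSymm) (x : β → ℝ) :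
    ∑ i, ∑ j, H i j * (x i - x j) ^ 2 =
      2 * (∑ i, (∑ j, H i j) * x i ^ 2 - x ⬝ᵥ H *ᵥ x) := by
  have e1 : ∀ i j, H i j * (x i - x j) ^ 2 =
      H i j * x i ^ 2 + H i j * x j ^ 2 - 2 * (x i * (H i j * x j)) := fun i j => by ring
  have e2 : ∑ i, ∑ j, H i j * x j ^ 2 = ∑ i, ∑ j, H i j * x i ^ 2 := by
    rw [Finset.sum_comm]
    exact Finset.sum_congr rfl fun i _ => Finset.sum_congr rfl fun j _ => by rw [hH.apply]
  simp only [e1, Finset.sum_sub_distrib, Finset.sum_add_distrib, e2, ← Finset.mul_sum,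
    dotProduct, mulVec, Finset.sum_mul]
  ring

/-- If the quadratic form of a nonnegative symmetric matrix is bounded by the squared norm of the
associated operator, and the support graph is connected, the form is nonpositive on the
orthogonal complement of the all-ones vector. -/
theorem quadratic_nonpos_of_le_sum_sq_div {H : Matrix β β ℝ} (hH : H.IsSymm)
    (hn : ∀ i j, 0 ≤ H i j)
    (hconn : ∀ x : β → ℝ, (∀ i j, 0 < H i j → x i = x j) →
      ∀ i j, 0 < ∑ k, H i k → 0 < ∑ k, H j k → x i = x j)
    (hq : ∀ x : β → ℝ, x ⬝ᵥ H *ᵥ x ≤ ∑ i, (H *ᵥ x) i ^ 2 / ∑ j, H i j)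
    {v : β → ℝ} (hv : ∑ i, (∑ j, H i j) * v i = 0) : v ⬝ᵥ H *ᵥ v ≤ 0 := by
  classical
  set D : β → ℝ := fun i => ∑ j, H i j with hD
  have hD0 : ∀ i, 0 ≤ D i := fun i => Finset.sum_nonneg fun j _ => hn i j
  set s : β → ℝ := fun i => √(D i) with hs
  have hss : ∀ i, s i * s i = D i := fun i => Real.mul_self_sqrt (hD0 i)
  have hs0 : ∀ i, s i = 0 → ∀ j, H i j = 0 := by
    intro i hi j
    have : D i = 0 := by rw [← hss, hi, zero_mul]
    exact (Finset.sum_eq_zero_iff_of_nonneg fun j _ => hn i j).1 this j (Finset.mem_univ j)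
  -- The normalised adjacency matrix `D^{-1/2} H D^{-1/2}`. Division by zero is harmless: a row of
  -- `H` with zero sum vanishes, by nonnegativity. The form is then expanded in an eigenbasis of
  -- `S`, and each term is shown to be nonpositive.
  set S : Matrix β β ℝ := Matrix.of fun i j => H i j / (s i * s j) with hSdef
  have hSH : ∀ i j, s i * S i j * s j = H i j := by
    intro i j
    by_cases hi : s i = 0
    · simp [hi, hs0 i hi j]
    by_cases hj : s j = 0
    · rw [← hH.apply i j, hs0 j hj i]
      simp [hj]
    simp only [hSdef, Matrix.of_apply]
    field_simp
  have hS : S.IsHermitian := by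
    ext i j
    simp [hSdef, hH.apply i j, mul_comm (s i)]
  set w : EuclideanSpace ℝ β := WithLp.toLp 2 fun i => s i * v i with hw
  have e1 : v ⬝ᵥ H *ᵥ v = inner ℝ w (WithLp.toLp 2 (S *ᵥ w.ofLp)) := by
    simp only [dotProduct, mulVec, PiLp.inner_apply, hw, Finset.mul_sum]
    refine Finset.sum_congr rfl fun i _ => ?_
    simp only [RCLike.inner_apply, conj_trivial, Finset.sum_mul]
    refine Finset.sum_congr rfl fun j _ => ?_
    rw [← hSH i j]
    ring
  have e2 : inner ℝ w (WithLp.toLp 2 (S *ᵥ w.ofLp)) =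
      ∑ k, hS.eigenvalues k * (inner ℝ w (hS.eigenvectorBasis k)) ^ 2 := by
    rw [← OrthonormalBasis.sum_inner_mul_inner hS.eigenvectorBasis]
    refine Finset.sum_congr rfl fun k _ => ?_
    have : inner ℝ (hS.eigenvectorBasis k) (WithLp.toLp 2 (S *ᵥ w.ofLp)) =
        hS.eigenvalues k * inner ℝ w (hS.eigenvectorBasis k) := by
      have h1 : ∀ x y : EuclideanSpace ℝ β, inner ℝ x y = x.ofLp ⬝ᵥ y.ofLp := by
        intro x y
        simp [PiLp.inner_apply, dotProduct, mul_comm]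
      have hSs : S.IsSymm := by simpa using hS
      rw [h1, h1, hSs.dotProduct_mulVec_comm, hS.mulVec_eigenvectorBasis, dotProduct_smul,
        smul_eq_mul]
    rw [this]
    ring
  rw [e1, e2]
  refine Finset.sum_nonpos fun k _ => ?_
  set u := hS.eigenvectorBasis k with hu
  set l := hS.eigenvalues k with hl
  rcases le_or_gt l 0 with hle | hpos
  · exact mul_nonpos_of_nonpos_of_nonneg hle (sq_nonneg _)
  have hSu : ∀ i, ∑ j, S i j * u.ofLp j = l * u.ofLp i := by
    intro i
    have := congrFun (hS.mulVec_eigenvectorBasis k) i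
    simpa [mulVec, dotProduct] using this
  have hu0 : ∀ i, s i = 0 → u.ofLp i = 0 := by
    intro i hi
    have := hSu i
    simp only [hSdef, Matrix.of_apply, hi, zero_mul, div_zero, Finset.sum_const_zero] at this
    exact (mul_eq_zero.1 this.symm).resolve_left hpos.ne'
  set x : β → ℝ := fun i => u.ofLp i / s i with hx
  have hsx : ∀ i, s i * x i = u.ofLp i := by
    intro i
    by_cases hi : s i = 0
    · rw [hu0 i hi, hi, zero_mul]
    · simp only [hx]
      field_simp
  have hHx : ∀ i, (H *ᵥ x) i = l * (D i * x i) := by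
    intro i
    have : (H *ᵥ x) i = s i * ∑ j, S i j * u.ofLp j := by
      simp only [mulVec, dotProduct, Finset.mul_sum]
      refine Finset.sum_congr rfl fun j _ => ?_
      rw [← hSH, ← hsx]
      ring
    rw [this, hSu, ← hsx, ← hss]
    ring
  have hnorm : ∑ i, D i * x i ^ 2 = 1 := by
    have h1 : ‖u‖ ^ 2 = 1 := by
      rw [hu, OrthonormalBasis.norm_eq_one, one_pow]
    rw [EuclideanSpace.real_norm_sq_eq] at h1
    rw [← h1]
    refine Finset.sum_congr rfl fun i _ => ?_
    rw [← hsx, ← hss]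
    ring
  have hqx : x ⬝ᵥ H *ᵥ x = l := by
    calc x ⬝ᵥ H *ᵥ x = ∑ i, x i * (l * (D i * x i)) := by simp only [dotProduct, hHx]
      _ = l * ∑ i, D i * x i ^ 2 := by
        rw [Finset.mul_sum]
        exact Finset.sum_congr rfl fun i _ => by ring
      _ = l := by rw [hnorm, mul_one]
  have hqx2 : ∑ i, (H *ᵥ x) i ^ 2 / D i = l ^ 2 := by
    calc ∑ i, (H *ᵥ x) i ^ 2 / D i = ∑ i, l ^ 2 * (D i * x i ^ 2) := by
          refine Finset.sum_congr rfl fun i _ => ?_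
          rw [hHx]
          by_cases hi : D i = 0
          · simp [hi]
          · field_simp
      _ = l ^ 2 := by rw [← Finset.mul_sum, hnorm, mul_one]
  -- At `x = D^{-1/2} u` the hypothesis `hq` reads `l ≤ l ^ 2`, so a positive eigenvalue is at least
  -- one. The Laplacian form at `x`, equal to `2 * (1 - l)`, must then be zero.
  have hl1 : 1 ≤ l := by
    have := hq x
    rw [hqx, hqx2] at this
    nlinarith
  have hlap := sum_mul_sub_sq hH x
  rw [hqx, hnorm] at hlap
  have hnn : ∀ i, ∀ j, 0 ≤ H i j * (x i - x j) ^ 2 := fun i j =>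
    mul_nonneg (hn i j) (sq_nonneg _)
  have hlap0 : ∑ i, ∑ j, H i j * (x i - x j) ^ 2 = 0 :=
    le_antisymm (by rw [hlap]; linarith)
      (Finset.sum_nonneg fun i _ => Finset.sum_nonneg fun j _ => hnn i j)
  have hxx : ∀ i j, 0 < H i j → x i = x j := by
    intro i j hij
    have h1 := (Finset.sum_eq_zero_iff_of_nonneg fun i _ => Finset.sum_nonneg fun j _ =>
      hnn i j).1 hlap0 i (Finset.mem_univ i)
    have h2 := (Finset.sum_eq_zero_iff_of_nonneg fun j _ => hnn i j).1 h1 j (Finset.mem_univ j)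
    have h3 := (mul_eq_zero.1 h2).resolve_left hij.ne'
    exact sub_eq_zero.1 (pow_eq_zero_iff two_ne_zero |>.1 h3)
  have hconst := hconn x hxx
  -- Since `x` is constant where `D` is positive, `u` is a multiple of `D^{1/2} 1`, which is
  -- orthogonal to `w` by `hv`.
  have hinner : inner ℝ w u = 0 := by
    have e : inner ℝ w u = ∑ i, D i * (x i * v i) := by
      simp only [PiLp.inner_apply, hw, RCLike.inner_apply, conj_trivial]
      refine Finset.sum_congr rfl fun i _ => ?_
      rw [← hsx, ← hss]
      ring
    rw [e]
    by_cases hall : ∀ i, D i = 0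
    · exact Finset.sum_eq_zero fun i _ => by rw [hall, zero_mul]
    push Not at hall
    obtain ⟨i₀, hi₀⟩ := hall
    have : ∀ i, D i * (x i * v i) = x i₀ * (D i * v i) := by
      intro i
      rcases (hD0 i).eq_or_lt with h | h
      · rw [← h]
        ring
      · rw [hconst i i₀ h (lt_of_le_of_ne (hD0 i₀) (Ne.symm hi₀))]
        ring
    rw [Finset.sum_congr rfl fun i _ => this i, ← Finset.mul_sum]
    exact mul_eq_zero_of_right _ hv
  rw [hinner]
  simp

/-- Local-to-global principle for the reverse Cauchy–Schwarz inequality. -/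
theorem Matrix.ReverseCauchySchwarz.of_local {H : Matrix β β ℝ} {Hk : β → Matrix β β ℝ} {m : ℝ}
    (hm : 0 < m) (hH : H.IsSymm) (hn : ∀ i j, 0 ≤ H i j) (hkn : ∀ k i j, 0 ≤ Hk k i j)
    (hsum : ∀ i j, ∑ k, Hk k i j = m * H i j)
    (hrow : ∀ k j, ∑ i, Hk k i j = m * H k j)
    (hR : ∀ k, (Hk k).ReverseCauchySchwarz)
    (hconn : ∀ x : β → ℝ, (∀ i j, 0 < H i j → x i = x j) →
      ∀ i j, 0 < ∑ k, H i k → 0 < ∑ k, H j k → x i = x j) :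
    H.ReverseCauchySchwarz := by
  have hD0 : ∀ i, 0 ≤ ∑ j, H i j := fun i => Finset.sum_nonneg fun j _ => hn i j
  have h11 : (1 : β → ℝ) ⬝ᵥ H *ᵥ 1 = ∑ i, ∑ j, H i j := by simp [dotProduct, mulVec]
  have hcol : ∀ k (v : β → ℝ), 1 ⬝ᵥ Hk k *ᵥ v = m * (H *ᵥ v) k := by
    intro k v
    simp only [dotProduct, mulVec, Pi.one_apply, one_mul]
    rw [Finset.sum_comm, Finset.mul_sum]
    refine Finset.sum_congr rfl fun j _ => ?_
    rw [← Finset.sum_mul, hrow, mul_assoc]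
  have hk1 : ∀ k, 1 ⬝ᵥ Hk k *ᵥ 1 = m * ∑ j, H k j := by
    intro k
    rw [hcol]
    simp [mulVec, dotProduct]
  refine ReverseCauchySchwarz.of_exists hH
    (h11 ▸ Finset.sum_nonneg fun i _ => hD0 i) fun v => ?_
  by_cases hzero : ∑ i, ∑ j, H i j = 0
  · refine ⟨0, ?_⟩
    rw [eq_zero_of_one_dotProduct_mulVec_one_nonpos hn (h11.trans hzero).le]
    simp
  -- The translate of `v` along `1` that is orthogonal to `1` for the weights `D`.
  refine ⟨-(∑ i, (∑ j, H i j) * v i) / ∑ i, ∑ j, H i j,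
    quadratic_nonpos_of_le_sum_sq_div hH hn hconn (fun x => ?_) ?_⟩
  -- This is the local inequality, since `1 ⬝ᵥ Hk k *ᵥ x = m * (H *ᵥ x) k`; summing it over `k`
  -- gives the bound on the global form.
  · have hle : ∀ k, x ⬝ᵥ Hk k *ᵥ x ≤ m * ((H *ᵥ x) k ^ 2 / ∑ j, H k j) := by
      intro k
      rcases (hD0 k).eq_or_lt with h | h
      · rw [eq_zero_of_one_dotProduct_mulVec_one_nonpos (hkn k) (by rw [hk1, ← h, mul_zero]),
          ← h]
        simp
      · have := hR k x
        rw [hk1, hcol] at this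
        rw [← mul_div_assoc, le_div_iff₀ h]
        nlinarith
    have hsumq : m * (x ⬝ᵥ H *ᵥ x) = ∑ k, x ⬝ᵥ Hk k *ᵥ x := by
      simp only [dotProduct, mulVec, Finset.mul_sum]
      rw [Finset.sum_comm]
      refine Finset.sum_comm.trans <| Eq.trans ?_ Finset.sum_comm
      refine Finset.sum_congr rfl fun i _ => ?_
      rw [Finset.sum_comm]
      refine Finset.sum_congr rfl fun j _ => ?_
      rw [← Finset.mul_sum, ← Finset.sum_mul, hsum]
      ring
    refine le_of_mul_le_mul_left ?_ hm
    rw [hsumq, Finset.mul_sum]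
    exact Finset.sum_le_sum fun k _ => hle k
  · simp only [Pi.add_apply, Pi.smul_apply, Pi.one_apply, smul_eq_mul, mul_one, mul_add,
      Finset.sum_add_distrib, ← Finset.sum_mul]
    field_simp
    ring

/-- Under the hypotheses of the local-to-global principle the kernel is contained in the kernels
of the local matrices. -/
theorem Matrix.mulVec_eq_zero_of_local {H : Matrix β β ℝ} {Hk : β → Matrix β β ℝ} {m : ℝ}
    (hksymm : ∀ k, (Hk k).IsSymm) (hkn : ∀ k i j, 0 ≤ Hk k i j)
    (hsum : ∀ i j, ∑ k, Hk k i j = m * H i j)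
    (hrow : ∀ k j, ∑ i, Hk k i j = m * H k j)
    (hR : ∀ k, (Hk k).ReverseCauchySchwarz) {v : β → ℝ} (hv : H *ᵥ v = 0) (k : β) :
    Hk k *ᵥ v = 0 := by
  have hcol : ∀ k, 1 ⬝ᵥ Hk k *ᵥ v = 0 := by
    intro k
    have : m * (H *ᵥ v) k = 0 := by rw [hv]; simp
    rw [← this]
    simp only [dotProduct, mulVec, Pi.one_apply, one_mul]
    rw [Finset.sum_comm, Finset.mul_sum]
    refine Finset.sum_congr rfl fun j _ => ?_
    rw [← Finset.sum_mul, hrow, mul_assoc]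
  have hnonpos : ∀ k, 0 < 1 ⬝ᵥ Hk k *ᵥ 1 → v ⬝ᵥ Hk k *ᵥ v ≤ 0 := by
    intro k hk
    have := hR k v
    rw [hcol] at this
    nlinarith
  have hzero : ∀ k, ¬ 0 < 1 ⬝ᵥ Hk k *ᵥ 1 → Hk k = 0 := fun k hk =>
    eq_zero_of_one_dotProduct_mulVec_one_nonpos (hkn k) (not_lt.1 hk)
  have hnonpos' : ∀ k, v ⬝ᵥ Hk k *ᵥ v ≤ 0 := by
    intro k
    by_cases hk : 0 < 1 ⬝ᵥ Hk k *ᵥ 1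
    · exact hnonpos k hk
    · simp [hzero k hk]
  -- Nonpositive terms with sum zero all vanish, so every nonzero local matrix is in the equality
  -- case.
  have hsumq : ∑ k, v ⬝ᵥ Hk k *ᵥ v = m * (v ⬝ᵥ H *ᵥ v) := by
    simp only [dotProduct, mulVec, Finset.mul_sum]
    rw [Finset.sum_comm]
    refine Finset.sum_congr rfl fun i _ => ?_
    rw [Finset.sum_comm]
    refine Finset.sum_congr rfl fun j _ => ?_
    rw [← Finset.mul_sum, ← Finset.sum_mul, hsum]
    ring
  rw [hv, dotProduct_zero, mul_zero] at hsumq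
  have hq := (Finset.sum_eq_zero_iff_of_nonpos fun k _ => hnonpos' k).1 hsumq k
    (Finset.mem_univ k)
  by_cases hk : 0 < 1 ⬝ᵥ Hk k *ᵥ 1
  · exact (hR k).mulVec_eq_zero (hksymm k) hk (hcol k) hq
  · simp [hzero k hk]

end ReverseCauchySchwarz

/-! ### Counting bases containing prescribed elements -/

section BasisCount

open Matrix

variable {β : Type*} [Fintype β]

open Classical in
/-- The matrix counting the bases that contain `S` and two further distinct elements. -/
noncomputable def basisCount (N : Matroid β) (S : Finset β) : Matrix β β ℕ :=
  Matrix.of fun i j => (Finset.univ.filter fun B : Finset β =>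
    N.IsBase (B : Set β) ∧ S ⊆ B ∧ (i ∈ B ∧ i ∉ S) ∧ (j ∈ B ∧ j ∉ S) ∧ i ≠ j).card

open Classical in
/-- The matrices of the local-to-global principle: the basis counts after adding one element. -/
noncomputable def localBasisCount (N : Matroid β) (S : Finset β) (k : β) : Matrix β β ℕ :=
  -- For `k ∈ S` the set `insert k S` is `S` itself and would contribute a spurious copy of
  -- `basisCount N S`.
  if k ∈ S then 0 else basisCount N (insert k S)

theorem basisCount_symm (N : Matroid β) (S : Finset β) (i j : β) :
    basisCount N S i j = basisCount N S j i := by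
  classical
  simp only [basisCount, Matrix.of_apply]
  congr 1
  ext B
  simp only [Finset.mem_filter]
  tauto

open Classical in
theorem localBasisCount_apply (N : Matroid β) (S : Finset β) (k i j : β) :
    localBasisCount N S k i j = (Finset.univ.filter fun B : Finset β =>
      N.IsBase (B : Set β) ∧ S ⊆ B ∧ (k ∈ B ∧ k ∉ S) ∧ (i ∈ B ∧ i ∉ S) ∧ (j ∈ B ∧ j ∉ S) ∧
        k ≠ i ∧ k ≠ j ∧ i ≠ j).card := by
  unfold localBasisCount
  split_ifs with h
  · simp [h]
  · simp only [basisCount, Matrix.of_apply]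
    congr 1
    ext B
    simp only [Finset.mem_filter, Finset.insert_subset_iff, Finset.mem_insert]
    grind

/-- Symmetry of third derivatives; it turns the sum over `k` into the row sums needed by the
local-to-global principle. -/
theorem localBasisCount_comm (N : Matroid β) (S : Finset β) (k i j : β) :
    localBasisCount N S k i j = localBasisCount N S i k j := by
  rw [localBasisCount_apply, localBasisCount_apply]
  congr 1
  ext B
  simp only [Finset.mem_filter]
  grind

/-- Double counting, or Euler's identity: a base counted by `basisCount N S i j` has `r - S.card -
2` further elements `k`. -/
theorem sum_localBasisCount {N : Matroid β} {r : ℕ}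
    (hr : ∀ B : Finset β, N.IsBase (B : Set β) → B.card = r) (S : Finset β) (i j : β) :
    ∑ k, localBasisCount N S k i j = (r - S.card - 2) * basisCount N S i j := by
  classical
  simp only [localBasisCount_apply, basisCount, Matrix.of_apply, Finset.card_filter]
  rw [Finset.sum_comm, Finset.mul_sum]
  refine Finset.sum_congr rfl fun B _ => ?_
  by_cases h : N.IsBase (B : Set β) ∧ S ⊆ B ∧ (i ∈ B ∧ i ∉ S) ∧ (j ∈ B ∧ j ∉ S) ∧ i ≠ j
  · rw [if_pos h, mul_one, ← Finset.card_filter]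
    obtain ⟨hB, hS, hi, hj, hij⟩ := h
    have : (Finset.univ.filter fun k => N.IsBase (B : Set β) ∧ S ⊆ B ∧ (k ∈ B ∧ k ∉ S) ∧
        (i ∈ B ∧ i ∉ S) ∧ (j ∈ B ∧ j ∉ S) ∧ k ≠ i ∧ k ≠ j ∧ i ≠ j) =
        ((B \ S).erase i).erase j := by
      ext k
      simp only [Finset.mem_filter, Finset.mem_univ, Finset.mem_erase, Finset.mem_sdiff]
      tauto
    rw [this, Finset.card_erase_of_mem (by simp [hj, hij.symm]),
      Finset.card_erase_of_mem (by simp [hi]), Finset.card_sdiff_of_subset hS, hr B hB]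
    lia
  · rw [if_neg h, mul_zero]
    refine Finset.sum_eq_zero fun k _ => if_neg ?_
    tauto

theorem exists_isBase_finset_superset {N : Matroid β} {T : Finset β}
    (hT : N.Indep (T : Set β)) : ∃ B : Finset β, N.IsBase (B : Set β) ∧ T ⊆ B := by
  classical
  obtain ⟨B, hB, hTB⟩ := hT.exists_isBase_superset
  exact ⟨B.toFinset, by simpa using hB, by
    rw [← Finset.coe_subset]
    simpa using hTB⟩

/-! ### Closures, corank two and parallel classes. -/

theorem notMem_closure_iff_insert {β : Type*} {N : Matroid β} (hE : N.E = Set.univ) {S : Set β}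
    (hS : N.Indep S) {i j : β} :
    (i ∉ N.closure S ∧ j ∉ N.closure (insert i S)) ↔
      (i ∉ S ∧ j ∉ S ∧ i ≠ j ∧ N.Indep (insert j (insert i S))) := by
  have hall : ∀ x, x ∈ N.E := fun x => hE ▸ Set.mem_univ x
  constructor
  · rintro ⟨hi, hj⟩
    have hi' := (hS.notMem_closure_iff (hall i)).1 hi
    have hj' := (hi'.1.notMem_closure_iff (hall j)).1 hj
    simp only [Set.mem_insert_iff, not_or] at hj'
    exact ⟨hi'.2, hj'.2.2, Ne.symm hj'.2.1, hj'.1⟩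
  · rintro ⟨hi, hj, hij, h⟩
    have hi' := h.subset (Set.subset_insert _ _)
    refine ⟨(hS.notMem_closure_iff (hall i)).2 ⟨hi', hi⟩,
      (hi'.notMem_closure_iff (hall j)).2 ⟨h, ?_⟩⟩
    simp [hj, hij.symm]

theorem basisCount_pos_iff {N : Matroid β} (hE : N.E = Set.univ) {S : Finset β}
    (hS : N.Indep (S : Set β)) {i j : β} :
    0 < basisCount N S i j ↔ i ∉ N.closure S ∧ j ∉ N.closure (insert i (S : Set β)) := by
  classical
  rw [notMem_closure_iff_insert hE hS]
  simp only [basisCount, Matrix.of_apply, Finset.card_pos]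
  constructor
  · rintro ⟨B, hB⟩
    obtain ⟨hB, hSB, hi, hj, hij⟩ := (Finset.mem_filter.1 hB).2
    refine ⟨by simpa using hi.2, by simpa using hj.2, hij, hB.indep.subset ?_⟩
    refine Set.insert_subset (by simpa using hj.1) (Set.insert_subset (by simpa using hi.1) ?_)
    simpa using hSB
  · rintro ⟨hi, hj, hij, h⟩
    have h' : N.Indep ((insert j (insert i S) : Finset β) : Set β) := by simpa using h
    obtain ⟨B, hB, hSB⟩ := exists_isBase_finset_superset h'
    simp only [Finset.insert_subset_iff] at hSB
    refine ⟨B, Finset.mem_filter.2 ⟨Finset.mem_univ _, hB, hSB.2.2, ?_⟩⟩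
    exact ⟨⟨hSB.2.1, by simpa using hi⟩, ⟨hSB.1, by simpa using hj⟩, hij⟩

/-- In corank two the only candidate base is `S ∪ {i, j}`. -/
theorem basisCount_le_one {N : Matroid β} {r : ℕ}
    (hr : ∀ B : Finset β, N.IsBase (B : Set β) → B.card = r) {S : Finset β}
    (hS : S.card + 2 = r) (i j : β) : basisCount N S i j ≤ 1 := by
  classical
  simp only [basisCount, Matrix.of_apply]
  refine Finset.card_le_one.2 ?_
  have key : ∀ B : Finset β, N.IsBase (B : Set β) → S ⊆ B → (i ∈ B ∧ i ∉ S) → (j ∈ B ∧ j ∉ S) →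
      i ≠ j → B = insert i (insert j S) := by
    intro B hB hSB hi hj hij
    refine (Finset.eq_of_subset_of_card_le ?_ ?_).symm
    · exact Finset.insert_subset hi.1 (Finset.insert_subset hj.1 hSB)
    · rw [hr B hB, Finset.card_insert_of_notMem (by simp [hij, hi.2]),
        Finset.card_insert_of_notMem hj.2]
      lia
  intro B hB B' hB'
  obtain ⟨h1, h2, h3, h4, h5⟩ := (Finset.mem_filter.1 hB).2
  obtain ⟨h1', h2', h3', h4', h5'⟩ := (Finset.mem_filter.1 hB').2
  rw [key B h1 h2 h3 h4 h5, key B' h1' h2' h3' h4' h5']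

open Classical in
theorem basisCount_eq_ite {N : Matroid β} (hE : N.E = Set.univ) {r : ℕ}
    (hr : ∀ B : Finset β, N.IsBase (B : Set β) → B.card = r) {S : Finset β}
    (hS : N.Indep (S : Set β)) (hSr : S.card + 2 = r) (i j : β) :
    basisCount N S i j =
      if i ∉ N.closure S ∧ j ∉ N.closure (insert i (S : Set β)) then 1 else 0 := by
  have h1 := basisCount_le_one hr hSr i j
  have h2 := basisCount_pos_iff hE hS (i := i) (j := j)
  split_ifs with h
  · have := h2.2 h
    lia
  · have := mt h2.1 h
    lia

theorem basisCount_eq_zero_of_not_indep {N : Matroid β} {S : Finset β}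
    (hS : ¬ N.Indep (S : Set β)) : basisCount N S = 0 := by
  classical
  ext i j
  simp only [basisCount, Matrix.of_apply, Matrix.zero_apply, Finset.card_eq_zero]
  refine Finset.filter_eq_empty_iff.2 ?_
  rintro B - ⟨hB, hSB, -⟩
  exact hS (hB.indep.subset (by simpa using hSB))

/-- Partition of the complement of a flat into the classes of parallel elements. -/
theorem closure_insert_eq_iff {β : Type*} {N : Matroid β} (hE : N.E = Set.univ) {S : Set β} {i j : β}
    (hj : j ∉ N.closure S) :
    N.closure (insert j S) = N.closure (insert i S) ↔ j ∈ N.closure (insert i S) := by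
  constructor
  · intro h
    rw [← h]
    exact N.mem_closure_of_mem' (Set.mem_insert _ _) (hE ▸ Set.mem_univ j)
  · intro h
    exact N.closure_insert_congr ⟨h, hj⟩

open Classical in
-- Grouping the nonloops by parallel class turns the expression into a sum of squares of class sums.
theorem sum_mul_sum_parallel_nonneg {N : Matroid β} (hE : N.E = Set.univ) (S : Set β)
    (w : β → ℝ) :
    0 ≤ ∑ i with i ∉ N.closure S,
      w i * ∑ j with j ∈ N.closure (insert i S) ∧ j ∉ N.closure S, w j := by
  set T : Finset β := Finset.univ.filter fun i => i ∉ N.closure S with hT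
  set g : β → Set β := fun i => N.closure (insert i S) with hg
  have h1 : ∀ i, ∑ j with j ∈ N.closure (insert i S) ∧ j ∉ N.closure S, w j =
      ∑ j ∈ T with g j = g i, w j := by
    intro i
    refine Finset.sum_congr ?_ fun _ _ => rfl
    ext j
    simp only [hT, Finset.mem_filter, Finset.mem_univ, true_and, hg]
    constructor
    · rintro ⟨h, h'⟩
      exact ⟨h', (closure_insert_eq_iff hE h').2 h⟩
    · rintro ⟨h', h⟩
      exact ⟨(closure_insert_eq_iff hE h').1 h, h'⟩
  rw [← Finset.sum_fiberwise_of_maps_to (t := T.image g)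
    (fun i hi => Finset.mem_image_of_mem g hi)]
  refine Finset.sum_nonneg fun c _ => ?_
  have h2 : ∀ i ∈ T.filter (fun i => g i = c),
      w i * ∑ j with j ∈ N.closure (insert i S) ∧ j ∉ N.closure S, w j =
        w i * ∑ j ∈ T with g j = c, w j := by
    intro i hi
    rw [h1, (Finset.mem_filter.1 hi).2]
  rw [Finset.sum_congr rfl h2, ← Finset.sum_mul]
  exact mul_self_nonneg _

open Classical in
-- By `hsum`, each class sum in `F` equals the total over the nonloops of `F`. Adding up the classes
-- makes the total equal to itself times the number of classes. As `i` and `k` lie in different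
-- classes, that number exceeds one and the total is zero.
theorem sum_parallel_class_eq_zero {N : Matroid β} (hE : N.E = Set.univ) {S F : Set β}
    {v : β → ℝ} (hF : ∀ k ∈ F, k ∉ N.closure S → N.closure (insert k S) ⊆ F)
    (hsum : ∀ k ∈ F, k ∉ N.closure S → ∑ j with j ∈ F ∧ j ∉ N.closure (insert k S), v j = 0)
    {i k : β} (hi : i ∈ F) (hiS : i ∉ N.closure S) (hk : k ∈ F)
    (hik : k ∉ N.closure (insert i S)) :
    ∑ j with j ∈ N.closure (insert i S) ∧ j ∉ N.closure S, v j = 0 := by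
  have hmono : ∀ l, N.closure S ⊆ N.closure (insert l S) := fun l =>
    N.closure_subset_closure (Set.subset_insert _ _)
  have hkS : k ∉ N.closure S := fun h => hik (hmono i h)
  set T : Finset β := Finset.univ.filter fun l => l ∈ F ∧ l ∉ N.closure S with hT
  set g : β → Set β := fun l => N.closure (insert l S) with hg
  have hclass : ∀ l ∈ F, l ∉ N.closure S →
      ∑ j with j ∈ N.closure (insert l S) ∧ j ∉ N.closure S, v j = ∑ j ∈ T, v j := by
    intro l hl hlS
    have h0 := hsum l hl hlS
    rw [← Finset.sum_filter_add_sum_filter_not T (fun j => j ∈ N.closure (insert l S))]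
    have e1 : T.filter (fun j => j ∈ N.closure (insert l S)) =
        Finset.univ.filter fun j => j ∈ N.closure (insert l S) ∧ j ∉ N.closure S := by
      ext j
      have h9 : j ∈ N.closure (insert l S) → j ∈ F := fun h => hF l hl hlS h
      simp only [hT, Finset.mem_filter, Finset.mem_univ, true_and]
      tauto
    have e2 : T.filter (fun j => ¬ j ∈ N.closure (insert l S)) =
        Finset.univ.filter fun j => j ∈ F ∧ j ∉ N.closure (insert l S) := by
      ext j
      have h9 : j ∈ N.closure S → j ∈ N.closure (insert l S) := fun h => hmono l h
      simp only [hT, Finset.mem_filter, Finset.mem_univ, true_and]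
      tauto
    rw [e1, e2, h0, add_zero]
  have hfib : ∀ c ∈ T.image g, ∑ j ∈ T with g j = c, v j = ∑ j ∈ T, v j := by
    intro c hc
    obtain ⟨l, hl, rfl⟩ := Finset.mem_image.1 hc
    obtain ⟨hlF, hlS⟩ := (Finset.mem_filter.1 hl).2
    rw [← hclass l hlF hlS]
    refine Finset.sum_congr ?_ fun _ _ => rfl
    ext j
    simp only [hT, Finset.mem_filter, Finset.mem_univ, true_and, hg]
    constructor
    · rintro ⟨h', h⟩
      exact ⟨(closure_insert_eq_iff hE h'.2).1 h, h'.2⟩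
    · rintro ⟨h, h'⟩
      exact ⟨⟨hF l hlF hlS h, h'⟩, (closure_insert_eq_iff hE h').2 h⟩
  have htot : ((T.image g).card : ℝ) * ∑ j ∈ T, v j = ∑ j ∈ T, v j := by
    rw [← nsmul_eq_mul, ← Finset.sum_const, ← Finset.sum_congr rfl hfib]
    exact Finset.sum_fiberwise_of_maps_to (fun i hi => Finset.mem_image_of_mem g hi) v
  have hiT : i ∈ T := by simp [hT, hi, hiS]
  have hkT : k ∈ T := by simp [hT, hk, hkS]
  have hcard : 1 < (T.image g).card := by
    refine Finset.one_lt_card.2 ⟨g i, Finset.mem_image_of_mem g hiT, g k,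
      Finset.mem_image_of_mem g hkT, fun h => hik ?_⟩
    exact (closure_insert_eq_iff hE hkS).1 h.symm
  rw [hclass i hi hiS]
  have : (1 : ℝ) < (T.image g).card := by exact_mod_cast hcard
  have h3 : (((T.image g).card : ℝ) - 1) * ∑ j ∈ T, v j = 0 := by linarith
  exact (mul_eq_zero.1 h3).resolve_left (by linarith)

open Classical in
-- Work in the flat `F` spanned by `S`, `i` and `k`. For each `l` in `F` outside the closure of `S`,
-- the complement in `F` of the closure of `insert l S` is a single parallel class over `insert l
-- S`, so `h` supplies the vanishing sums required by `sum_parallel_class_eq_zero`.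
theorem sum_parallel_class_eq_zero_of_insert {N : Matroid β} (hE : N.E = Set.univ) {S : Set β}
    {v : β → ℝ}
    (h : ∀ k, k ∉ N.closure S → ∀ i, i ∉ N.closure (insert k S) →
      ∑ j with j ∈ N.closure (insert i (insert k S)) ∧ j ∉ N.closure (insert k S), v j = 0)
    {i k : β} (hiS : i ∉ N.closure S) (hik : k ∉ N.closure (insert i S)) :
    ∑ j with j ∈ N.closure (insert i S) ∧ j ∉ N.closure S, v j = 0 := by
  have hall : ∀ x, x ∈ N.E := fun x => hE ▸ Set.mem_univ x
  have hEs : ∀ X : Set β, X ⊆ N.E := fun X => hE ▸ Set.subset_univ X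
  have hmem : ∀ {x : β} {X : Set β}, x ∈ X → x ∈ N.closure X := fun hx =>
    N.mem_closure_of_mem' hx (hall _)
  set F := N.closure (insert k (insert i S)) with hF
  -- By exchange, `l` together with `k` or `i` spans `F` over `S`: use `k` when `l` is parallel to
  -- `i`, and `i` otherwise.
  have key : ∀ l ∈ F, l ∉ N.closure S →
      ∃ m, m ∉ N.closure (insert l S) ∧ N.closure (insert m (insert l S)) = F := by
    intro l hl hlS
    by_cases hil : i ∈ N.closure (insert l S)
    · have heq := N.closure_insert_congr ⟨hil, hiS⟩
      exact ⟨k, heq ▸ hik, N.closure_insert_congr_right heq.symm⟩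
    · refine ⟨i, hil, ?_⟩
      have hli : l ∉ N.closure (insert i S) := fun h' => hil (N.mem_closure_insert hlS h')
      rw [Set.insert_comm]
      exact N.closure_insert_congr ⟨hl, hli⟩
  refine sum_parallel_class_eq_zero hE (F := F) (fun l hl hlS => ?_) (fun l hl hlS => ?_)
    (hmem (by simp)) hiS (hmem (by simp)) hik
  · obtain ⟨m, -, hm⟩ := key l hl hlS
    rw [← hm]
    exact N.closure_subset_closure (Set.subset_insert _ _)
  · obtain ⟨m, hm', hm⟩ := key l hl hlS
    rw [← hm]
    exact h l hlS m hm'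

end BasisCount

/-! ### Reverse Cauchy–Schwarz and nonsingularity for basis counts. -/

section BasisCountHessian

open Matrix

variable {β : Type*} [Fintype β]

/-- The real matrix of basis counts. -/
noncomputable def realBasisCount (N : Matroid β) (S : Finset β) : Matrix β β ℝ :=
  (basisCount N S).map (Nat.cast : ℕ → ℝ)

theorem realBasisCount_isSymm (N : Matroid β) (S : Finset β) : (realBasisCount N S).IsSymm := by
  ext i j
  simp [realBasisCount, basisCount_symm N S i j]

theorem realBasisCount_nonneg (N : Matroid β) (S : Finset β) (i j : β) :
    0 ≤ realBasisCount N S i j := by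
  simp [realBasisCount]

open Classical in
theorem realBasisCount_mulVec {N : Matroid β} (hE : N.E = Set.univ) {r : ℕ}
    (hr : ∀ B : Finset β, N.IsBase (B : Set β) → B.card = r) {S : Finset β}
    (hS : N.Indep (S : Set β)) (hSr : S.card + 2 = r) (v : β → ℝ) (i : β) :
    (realBasisCount N S *ᵥ v) i = if i ∉ N.closure S then
      ∑ j with j ∉ N.closure (insert i (S : Set β)), v j else 0 := by
  simp only [mulVec, dotProduct, realBasisCount, Matrix.map_apply,
    basisCount_eq_ite hE hr hS hSr, Finset.sum_filter]
  by_cases h : i ∉ N.closure (S : Set β)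
  · rw [if_pos h]
    refine Finset.sum_congr rfl fun j _ => ?_
    by_cases hj : j ∉ N.closure (insert i (S : Set β)) <;> simp [h, hj]
  · rw [if_neg h]
    exact Finset.sum_eq_zero fun j _ => by simp [h]

/-- Two nonloops over `S` are either adjacent in the support graph or parallel, and parallel
elements have the same neighbours. -/
theorem realBasisCount_connected {N : Matroid β} (hE : N.E = Set.univ) {S : Finset β}
    (hS : N.Indep (S : Set β)) (x : β → ℝ)
    (hx : ∀ i j, 0 < realBasisCount N S i j → x i = x j) (i j : β)
    (hi : 0 < ∑ k, realBasisCount N S i k) (hj : 0 < ∑ k, realBasisCount N S j k) :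
    x i = x j := by
  have hpos : ∀ i j, 0 < realBasisCount N S i j ↔
      i ∉ N.closure S ∧ j ∉ N.closure (insert i (S : Set β)) := by
    intro i j
    rw [← basisCount_pos_iff hE hS]
    simp [realBasisCount]
  obtain ⟨k, -, hk⟩ := Finset.exists_lt_of_sum_lt (s := Finset.univ) (f := fun _ => (0 : ℝ))
    (g := fun k => realBasisCount N S i k) (by simpa using hi)
  obtain ⟨l, -, hl⟩ := Finset.exists_lt_of_sum_lt (s := Finset.univ) (f := fun _ => (0 : ℝ))
    (g := fun k => realBasisCount N S j k) (by simpa using hj)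
  have hk' := (hpos i k).1 hk
  have hl' := (hpos j l).1 hl
  by_cases hij : j ∈ N.closure (insert i (S : Set β))
  · have heq := N.closure_insert_congr ⟨hij, hl'.1⟩
    rw [hx i k hk, hx j k ((hpos j k).2 ⟨hl'.1, heq ▸ hk'.2⟩)]
  · exact hx i j ((hpos i j).2 ⟨hk'.1, hij⟩)

/-- On vectors whose sum over the nonloops is zero, the complete multipartite form is minus the sum
of squares of the class sums. Subtracting the mean over the nonloops reaches such a vector. -/
theorem realBasisCount_reverseCauchySchwarz_of_card_add_two {N : Matroid β}
    (hE : N.E = Set.univ) {r : ℕ}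
    (hr : ∀ B : Finset β, N.IsBase (B : Set β) → B.card = r) {S : Finset β}
    (hS : N.Indep (S : Set β)) (hSr : S.card + 2 = r) :
    (realBasisCount N S).ReverseCauchySchwarz := by
  classical
  refine ReverseCauchySchwarz.of_exists (realBasisCount_isSymm N S) ?_ fun v => ?_
  · simp only [dotProduct, mulVec, Pi.one_apply, one_mul, mul_one]
    exact Finset.sum_nonneg fun i _ => Finset.sum_nonneg fun j _ => realBasisCount_nonneg N S i j
  set T : Finset β := Finset.univ.filter fun i => i ∉ N.closure S with hT
  refine ⟨-(∑ i ∈ T, v i) / T.card, ?_⟩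
  set w := v + (-(∑ i ∈ T, v i) / (T.card : ℝ)) • (1 : β → ℝ) with hw
  have hsum : ∑ i ∈ T, w i = 0 := by
    rcases T.eq_empty_or_nonempty with h | h
    · simp [h]
    · have : (T.card : ℝ) ≠ 0 := by exact_mod_cast h.card_pos.ne'
      simp only [hw, Pi.add_apply, Pi.smul_apply, Pi.one_apply, smul_eq_mul, mul_one,
        Finset.sum_add_distrib, Finset.sum_const, nsmul_eq_mul]
      field_simp
      ring
  have hcompl : ∀ i, ∑ j with j ∉ N.closure (insert i (S : Set β)), w j =
      -∑ j with j ∈ N.closure (insert i (S : Set β)) ∧ j ∉ N.closure S, w j := by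
    intro i
    rw [eq_neg_iff_add_eq_zero, ← hsum,
      ← Finset.sum_filter_add_sum_filter_not T (fun j => j ∉ N.closure (insert i (S : Set β)))]
    congr 1
    · refine Finset.sum_congr ?_ fun _ _ => rfl
      ext j
      have : j ∈ N.closure (S : Set β) → j ∈ N.closure (insert i (S : Set β)) := fun h =>
        N.closure_subset_closure (Set.subset_insert _ _) h
      simp only [hT, Finset.mem_filter, Finset.mem_univ, true_and]
      tauto
    · refine Finset.sum_congr ?_ fun _ _ => rfl
      ext j
      simp only [hT, Finset.mem_filter, Finset.mem_univ, true_and]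
      tauto
  have hq : w ⬝ᵥ realBasisCount N S *ᵥ w = -∑ i with i ∉ N.closure S,
      w i * ∑ j with j ∈ N.closure (insert i (S : Set β)) ∧ j ∉ N.closure S, w j := by
    simp only [dotProduct, realBasisCount_mulVec hE hr hS hSr, hcompl]
    rw [Finset.sum_filter, ← Finset.sum_neg_distrib]
    refine Finset.sum_congr rfl fun i _ => ?_
    split_ifs <;> simp
  rw [hq]
  exact neg_nonpos.2 (sum_mul_sum_parallel_nonneg hE _ w)

/-- The real version of the local matrices. -/
noncomputable def realLocalBasisCount (N : Matroid β) (S : Finset β) (k : β) : Matrix β β ℝ :=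
  (localBasisCount N S k).map (Nat.cast : ℕ → ℝ)

theorem realLocalBasisCount_nonneg (N : Matroid β) (S : Finset β) (k i j : β) :
    0 ≤ realLocalBasisCount N S k i j := by
  simp [realLocalBasisCount]

open Classical in
theorem realLocalBasisCount_cases (N : Matroid β) (S : Finset β) (k : β) :
    realLocalBasisCount N S k = 0 ∨
      (k ∉ S ∧ N.Indep ((insert k S : Finset β) : Set β) ∧
        realLocalBasisCount N S k = realBasisCount N (insert k S)) := by
  by_cases hk : k ∈ S
  · left
    ext
    simp [realLocalBasisCount, localBasisCount, hk]
  by_cases hI : N.Indep ((insert k S : Finset β) : Set β)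
  · right
    refine ⟨hk, hI, ?_⟩
    ext i j
    simp [realLocalBasisCount, localBasisCount, hk, realBasisCount]
  · left
    ext
    simp [realLocalBasisCount, localBasisCount, hk, basisCount_eq_zero_of_not_indep hI]

theorem realLocalBasisCount_isSymm (N : Matroid β) (S : Finset β) (k : β) :
    (realLocalBasisCount N S k).IsSymm := by
  classical
  rcases realLocalBasisCount_cases N S k with h | ⟨-, -, h⟩ <;> rw [h]
  · exact Matrix.isSymm_zero
  · exact realBasisCount_isSymm _ _

theorem sum_realLocalBasisCount {N : Matroid β} {r : ℕ}
    (hr : ∀ B : Finset β, N.IsBase (B : Set β) → B.card = r) (S : Finset β) (i j : β) :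
    ∑ k, realLocalBasisCount N S k i j = ((r - S.card - 2 : ℕ) : ℝ) * realBasisCount N S i j := by
  simp only [realLocalBasisCount, realBasisCount, Matrix.map_apply]
  rw [← Nat.cast_sum, sum_localBasisCount hr, Nat.cast_mul]

theorem sum_row_realLocalBasisCount {N : Matroid β} {r : ℕ}
    (hr : ∀ B : Finset β, N.IsBase (B : Set β) → B.card = r) (S : Finset β) (k j : β) :
    ∑ i, realLocalBasisCount N S k i j = ((r - S.card - 2 : ℕ) : ℝ) * realBasisCount N S k j := by
  rw [← sum_realLocalBasisCount hr]
  refine Finset.sum_congr rfl fun i _ => ?_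
  simp only [realLocalBasisCount, Matrix.map_apply, localBasisCount_comm N S k i j]

theorem realBasisCount_reverseCauchySchwarz {N : Matroid β} (hE : N.E = Set.univ) {r : ℕ}
    (hr : ∀ B : Finset β, N.IsBase (B : Set β) → B.card = r) (d : ℕ) {S : Finset β}
    (hS : N.Indep (S : Set β)) (hSr : S.card + 2 + d = r) :
    (realBasisCount N S).ReverseCauchySchwarz := by
  classical
  induction d generalizing S with
  | zero => exact realBasisCount_reverseCauchySchwarz_of_card_add_two hE hr hS hSr
  | succ d ih =>
    refine ReverseCauchySchwarz.of_local (Hk := realLocalBasisCount N S)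
      (m := ((r - S.card - 2 : ℕ) : ℝ)) (by norm_cast; lia)
      (realBasisCount_isSymm N S) (realBasisCount_nonneg N S) (realLocalBasisCount_nonneg N S)
      (sum_realLocalBasisCount hr S) (sum_row_realLocalBasisCount hr S) (fun k => ?_)
      (realBasisCount_connected hE hS)
    rcases realLocalBasisCount_cases N S k with h | ⟨hk, hI, h⟩ <;> rw [h]
    · intro v
      simp
    · refine ih hI ?_
      rw [Finset.card_insert_of_notMem hk]
      lia

theorem exists_notMem_closure {β : Type*} {N : Matroid β} {r : ℕ}
    (hr : ∀ B : Finset β, N.IsBase (B : Set β) → B.card = r) {S : Finset β}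
    (hS : N.Indep (S : Set β)) (hSr : S.card < r) : ∃ k, k ∉ N.closure S := by
  by_contra! h
  have hB : N.IsBase (S : Set β) := Matroid.isBase_iff_indep_closure_eq.2
    ⟨hS, (N.closure_subset_ground _).antisymm (fun k _ => h k)⟩
  exact hSr.ne (hr S hB)

open Classical in
theorem sum_parallel_class_eq_zero_of_mulVec {N : Matroid β} (hE : N.E = Set.univ) {r : ℕ}
    (hr : ∀ B : Finset β, N.IsBase (B : Set β) → B.card = r) {v : β → ℝ} (d : ℕ)
    {S : Finset β} (hS : N.Indep (S : Set β)) (hSr : S.card + 2 + d = r)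
    (hv : realBasisCount N S *ᵥ v = 0) {i : β} (hi : i ∉ N.closure S) :
    ∑ j with j ∈ N.closure (insert i (S : Set β)) ∧ j ∉ N.closure S, v j = 0 := by
  have hall : ∀ x, x ∈ N.E := fun x => hE ▸ Set.mem_univ x
  have hins : ∀ k, k ∉ N.closure S → k ∉ S ∧ N.Indep ((insert k S : Finset β) : Set β) := by
    intro k hk
    have := (hS.notMem_closure_iff (hall k)).1 hk
    exact ⟨by simpa using this.2, by simpa using this.1⟩
  induction d generalizing S i with
  | zero =>
    obtain ⟨hiS, hiI⟩ := hins i hi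
    obtain ⟨k, hk⟩ := exists_notMem_closure hr hiI
      (by rw [Finset.card_insert_of_notMem hiS]; lia)
    -- In corank two, the kernel equation at a nonloop `k` says that `v` sums to zero off the
    -- closure of `insert k S`.
    refine sum_parallel_class_eq_zero hE (F := Set.univ) (fun _ _ _ => Set.subset_univ _)
      (fun k _ hk => ?_) (Set.mem_univ i) hi (Set.mem_univ k) (by simpa using hk)
    have := congrFun hv k
    rw [realBasisCount_mulVec hE hr hS (by simpa using hSr), if_pos hk] at this
    simpa using this
  | succ d ih =>
    obtain ⟨hiS, hiI⟩ := hins i hi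
    obtain ⟨k, hk⟩ := exists_notMem_closure hr hiI
      (by rw [Finset.card_insert_of_notMem hiS]; lia)
    refine sum_parallel_class_eq_zero_of_insert hE (k := k) (fun k hk l hl => ?_) hi
      (by simpa using hk)
    obtain ⟨hkS, hkI⟩ := hins k hk
    have hker : realLocalBasisCount N S k *ᵥ v = 0 := by
      refine Matrix.mulVec_eq_zero_of_local (realLocalBasisCount_isSymm N S)
        (realLocalBasisCount_nonneg N S)
        (sum_realLocalBasisCount hr S) (sum_row_realLocalBasisCount hr S) (fun k => ?_) hv k
      rcases realLocalBasisCount_cases N S k with h | ⟨hk, hI, h⟩ <;> rw [h]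
      · intro v
        simp
      · refine realBasisCount_reverseCauchySchwarz hE hr d hI ?_
        rw [Finset.card_insert_of_notMem hk]
        lia
    have hker' : realBasisCount N (insert k S) *ᵥ v = 0 := by
      rw [← hker]
      congr 1
      ext i j
      simp only [realLocalBasisCount, localBasisCount, hkS, if_false, realBasisCount]
    have := ih hkI (by rw [Finset.card_insert_of_notMem hkS]; lia) hker' (i := l)
      (by simpa using hl) (fun m hm => by
        have := (hkI.notMem_closure_iff (hall m)).1 hm
        exact ⟨by simpa using this.2, by simpa using this.1⟩)
    simpa using this

/-- The basis count matrix of a simple matroid of rank at least two is nonsingular. -/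
theorem realBasisCount_mulVec_injective {N : Matroid β} (hE : N.E = Set.univ) {r : ℕ}
    (hr2 : 2 ≤ r) (hr : ∀ B : Finset β, N.IsBase (B : Set β) → B.card = r)
    (hsimple : ∀ i j, N.Indep {i, j}) {v : β → ℝ}
    (hv : realBasisCount N ∅ *ᵥ v = 0) : v = 0 := by
  classical
  have hall : ∀ x, x ∈ N.E := fun x => hE ▸ Set.mem_univ x
  have h1 : ∀ i, i ∉ N.closure ((∅ : Finset β) : Set β) := by
    intro i
    rw [Finset.coe_empty, N.empty_indep.notMem_closure_iff (hall i)]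
    -- Taking both elements equal in `hsimple` rules out loops.
    simpa using hsimple i i
  ext i
  have := sum_parallel_class_eq_zero_of_mulVec hE hr (r - 2) (S := ∅) (by simp)
    (by simp; lia) hv (h1 i)
  have hfil : (Finset.univ.filter fun j => j ∈ N.closure (insert i ((∅ : Finset β) : Set β)) ∧
      j ∉ N.closure ((∅ : Finset β) : Set β)) = {i} := by
    ext j
    rw [Finset.mem_filter, Finset.mem_singleton, and_iff_left (h1 j),
      and_iff_right (Finset.mem_univ j), Finset.coe_empty, insert_empty_eq]
    constructor
    · intro hj
      by_contra hji
      have hi : N.Indep {i} := (hsimple i i).subset (by simp)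
      exact (hi.notMem_closure_iff (hall j)).2 ⟨hsimple j i, by simpa using hji⟩ hj
    · rintro rfl
      exact N.mem_closure_of_mem' (Set.mem_singleton j) (hall j)
  rw [hfil, Finset.sum_singleton] at this
  simpa using this

theorem basisCount_det_cast [DecidableEq β] (N : Matroid β) (S : Finset β) (R : Type*)
    [CommRing R] : ((basisCount N S).map (Nat.cast : ℕ → R)).det =
      (((basisCount N S).map (Nat.cast : ℕ → ℤ)).det : R) := by
  rw [← eq_intCast (Int.castRingHom R), RingHom.map_det]
  congr 1
  ext i j
  simp

theorem basisCount_det_ne_zero (K : Type*) [Field K] [CharZero K] [DecidableEq β]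
    {N : Matroid β} (hE : N.E = Set.univ) {r : ℕ}
    (hr2 : 2 ≤ r) (hr : ∀ B : Finset β, N.IsBase (B : Set β) → B.card = r)
    (hsimple : ∀ i j, N.Indep {i, j}) :
    ((basisCount N ∅).map (Nat.cast : ℕ → K)).det ≠ 0 := by
  have hreal : ((basisCount N ∅).map (Nat.cast : ℕ → ℝ)).det ≠ 0 := by
    intro h
    obtain ⟨v, hv, hv0⟩ := Matrix.exists_mulVec_eq_zero_iff.2 h
    exact hv (realBasisCount_mulVec_injective hE hr2 hr hsimple hv0)
  rw [basisCount_det_cast] at hreal ⊢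
  rw [Int.cast_ne_zero] at hreal ⊢
  exact hreal

end BasisCountHessian

/-! ### Constant coefficient differential operators on homogeneous polynomials -/

section DiffOp

variable {K : Type*} [Field K] {σ : Type*}

theorem diffOp_X_apply (i : σ) (F : MvPolynomial σ K) : diffOp K σ (X i) F = pderiv i F := by
  rw [diffOp_X]
  rfl

theorem diffOp_mul_apply (P Q F : MvPolynomial σ K) :
    diffOp K σ (P * Q) F = diffOp K σ P (diffOp K σ Q F) := by
  rw [map_mul]
  rfl

theorem diffOp_C_mul_apply (a : K) (P F : MvPolynomial σ K) :
    diffOp K σ (C a * P) F = C a * diffOp K σ P F := by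
  rw [C_mul', map_smul, C_mul', LinearMap.smul_apply]

theorem isHomogeneous_diffOp_monomial (d : σ →₀ ℕ) {n : ℕ} {F : MvPolynomial σ K}
    (hF : F.IsHomogeneous n) : (diffOp K σ (monomial d 1) F).IsHomogeneous (n - d.degree) := by
  induction d using Finsupp.induction_linear generalizing n F with
  | zero => simpa using hF
  | add d e hd he =>
    have : (monomial (d + e) (1 : K)) = monomial d 1 * monomial e 1 := by simp
    rw [this, diffOp_mul_apply]
    convert hd (he hF) using 1
    rw [map_add]
    lia
  | single i k =>
    rw [← X_pow_eq_monomial, Finsupp.degree_single]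
    induction k generalizing n F with
    | zero => simpa using hF
    | succ k ih =>
      rw [pow_succ, diffOp_mul_apply, diffOp_X_apply]
      convert ih hF.pderiv using 1
      lia

theorem isHomogeneous_diffOp {k n : ℕ} {P F : MvPolynomial σ K}
    (hP : P.IsHomogeneous k) (hF : F.IsHomogeneous n) :
    (diffOp K σ P F).IsHomogeneous (n - k) := by
  rw [P.as_sum, map_sum, LinearMap.sum_apply]
  refine IsHomogeneous.sum _ _ _ fun d hd => ?_
  have h1 : monomial d (coeff d P) = C (coeff d P) * monomial d 1 := by
    rw [C_mul_monomial, mul_one]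
  have h2 : d.degree = k := by
    rw [Finsupp.degree_eq_weight_one]
    exact hP (mem_support_iff.1 hd)
  rw [h1, diffOp_C_mul_apply, ← h2]
  exact (isHomogeneous_diffOp_monomial d hF).C_mul _

variable [Fintype σ]

theorem diffOp_sum_X_apply (F : MvPolynomial σ K) :
    diffOp K σ (∑ i, X i) F = ∑ i, pderiv i F := by
  rw [map_sum, LinearMap.sum_apply]
  exact Finset.sum_congr rfl fun i _ => diffOp_X_apply i F

/-- By Euler's identity at the all-ones point, each application of `∑ ∂_i` multiplies the value
there by the current degree. -/
theorem diffOp_sum_X_pow_apply {k : ℕ} {F : MvPolynomial σ K} (hF : F.IsHomogeneous k) :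
    diffOp K σ ((∑ i, X i) ^ k) F = C ((k.factorial : K) * eval 1 F) := by
  induction k generalizing F with
  | zero =>
    have hc : F = C (coeff 0 F) := totalDegree_eq_zero_iff_eq_C.1 (by simpa using hF.totalDegree_le)
    rw [hc]
    simp
  | succ k ih =>
    have hD : (∑ i, pderiv i F).IsHomogeneous k :=
      IsHomogeneous.sum _ _ _ fun i _ => hF.pderiv
    rw [pow_succ, diffOp_mul_apply, diffOp_sum_X_apply, ih hD]
    have := congrArg (eval (1 : σ → K)) hF.sum_X_mul_pderiv
    simp only [map_sum, map_mul, eval_X, Pi.one_apply, one_mul, nsmul_eq_mul, map_natCast] at this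
    rw [map_sum, this, Nat.factorial_succ]
    push_cast
    ring_nf

theorem exists_eq_sum_C_mul_X {P : MvPolynomial σ K} (hP : P.IsHomogeneous 1) :
    ∃ c : σ → K, P = ∑ i, C (c i) * X i := by
  have h : ∀ i, ∃ c, pderiv i P = C c := fun i =>
    ⟨_, totalDegree_eq_zero_iff_eq_C.1 (by simpa using (hP.pderiv (i := i)).totalDegree_le)⟩
  choose c hc using h
  refine ⟨c, ?_⟩
  conv_lhs => rw [← one_nsmul P, ← hP.sum_X_mul_pderiv]
  exact Finset.sum_congr rfl fun i _ => by rw [hc, mul_comm]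

theorem eq_zero_of_pderiv_eq_zero {P : MvPolynomial σ K} (hP : P.IsHomogeneous 1)
    (h : ∀ i, pderiv i P = 0) : P = 0 := by
  rw [← one_nsmul P, ← hP.sum_X_mul_pderiv]
  exact Finset.sum_eq_zero fun i _ => by rw [h, mul_zero]

/-- The Hessian matrix at the all-ones vector. -/
noncomputable def hessianAtOne (F : MvPolynomial σ K) : Matrix σ σ K :=
  Matrix.of fun i j => eval 1 (pderiv i (pderiv j F))

theorem pderiv_diffOp_sum_X_pow_mul {r : ℕ} {F : MvPolynomial σ K} (hF : F.IsHomogeneous r)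
    (c : σ → K) (i : σ) :
    pderiv i (diffOp K σ ((∑ j, X j) ^ (r - 2) * ∑ j, C (c j) * X j) F) =
      C (((r - 2).factorial : K) * (hessianAtOne F).mulVec c i) := by
  rw [← diffOp_X_apply, ← diffOp_mul_apply, mul_left_comm, diffOp_mul_apply, diffOp_mul_apply]
  have h1 : diffOp K σ (∑ j, C (c j) * X j) F = ∑ j, C (c j) * pderiv j F := by
    rw [map_sum, LinearMap.sum_apply]
    exact Finset.sum_congr rfl fun j _ => by rw [diffOp_C_mul_apply, diffOp_X_apply]
  have h2 : (∑ j, C (c j) * pderiv j F).IsHomogeneous (r - 1) :=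
    IsHomogeneous.sum _ _ _ fun j _ => hF.pderiv.C_mul _
  have h3 : (pderiv i (∑ j, C (c j) * pderiv j F)).IsHomogeneous (r - 2) := h2.pderiv
  rw [h1, diffOp_X_apply, diffOp_sum_X_pow_apply h3]
  simp only [map_sum, pderiv_C_mul, Matrix.mulVec, dotProduct, hessianAtOne, Matrix.of_apply,
    map_mul, eval_C]
  simp only [mul_comm]

/-- If the Hessian of a form `F` is nonsingular at the all-ones vector, then a power of the sum
of the variables maps the linear part of the algebra of `F` bijectively onto the part of
complementary degree. -/
theorem bijOn_sum_X_pow_mul [CharZero K] [DecidableEq σ] {r : ℕ} (hr : 2 ≤ r)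
    {F : MvPolynomial σ K} (hF : F.IsHomogeneous r) (hH : (hessianAtOne F).det ≠ 0) :
    Set.BijOn (fun a : MvPolynomial σ K ⧸ annIdeal F =>
        Ideal.Quotient.mk _ (∑ i, X i) ^ (r - 2) * a)
      ((homogeneousSubmodule σ K 1).map (Ideal.Quotient.mkₐ K (annIdeal F)).toLinearMap)
      ((homogeneousSubmodule σ K (r - 1)).map
        (Ideal.Quotient.mkₐ K (annIdeal F)).toLinearMap) := by
  have hL : ((∑ i, X i : MvPolynomial σ K) ^ (r - 2)).IsHomogeneous (r - 2) := by
    simpa using (IsHomogeneous.sum Finset.univ (fun i => (X i : MvPolynomial σ K)) 1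
      fun i _ => isHomogeneous_X K i).pow (r - 2)
  have hprod : ∀ p : MvPolynomial σ K, p.IsHomogeneous 1 →
      ((∑ i, X i) ^ (r - 2) * p).IsHomogeneous (r - 1) := by
    intro p hp
    convert hL.mul hp using 1
    lia
  have hfac : ((r - 2).factorial : K) ≠ 0 := by exact_mod_cast Nat.factorial_ne_zero _
  have hmem : ∀ P, P ∈ annIdeal F ↔ diffOp K σ P F = 0 := fun P => Iff.rfl
  refine ⟨?_, ?_, ?_⟩
  · rintro _ ⟨p, hp, rfl⟩
    refine ⟨(∑ i, X i) ^ (r - 2) * p, hprod p hp, ?_⟩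
    simp
  · rintro _ ⟨p, hp, rfl⟩ _ ⟨q, hq, rfl⟩ h
    obtain ⟨c, hc⟩ := exists_eq_sum_C_mul_X (IsHomogeneous.sub hp hq)
    have h' : diffOp K σ ((∑ i, X i) ^ (r - 2) * (p - q)) F = 0 := by
      rw [← hmem, mul_sub, ← Ideal.Quotient.eq]
      simpa using h
    have hHc : (hessianAtOne F).mulVec c = 0 := by
      ext i
      have := pderiv_diffOp_sum_X_pow_mul hF c i
      rw [← hc, h', map_zero] at this
      exact (mul_eq_zero.1 (C_eq_zero.1 this.symm)).resolve_left hfac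
    have hc0 : c = 0 := Matrix.eq_zero_of_mulVec_eq_zero hH hHc
    have : p - q = 0 := by
      rw [hc, hc0]
      simp
    rw [sub_eq_zero.1 this]
  · rintro _ ⟨Q, hQ, rfl⟩
    have hl : (diffOp K σ Q F).IsHomogeneous 1 := by
      convert isHomogeneous_diffOp hQ hF using 1
      lia
    have hd : ∀ i, ∃ l, pderiv i (diffOp K σ Q F) = C l := fun i =>
      ⟨_, totalDegree_eq_zero_iff_eq_C.1 (by simpa using (hl.pderiv (i := i)).totalDegree_le)⟩
    choose l hl' using hd
    -- The inverse factorial cancels the one in `pderiv_diffOp_sum_X_pow_mul`, so that both linear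
    -- forms have the same partial derivatives.
    obtain ⟨c, hc⟩ : ∃ c, (hessianAtOne F).mulVec c = ((r - 2).factorial : K)⁻¹ • l := by
      refine ⟨(hessianAtOne F)⁻¹.mulVec (((r - 2).factorial : K)⁻¹ • l), ?_⟩
      rw [Matrix.mulVec_mulVec, Matrix.mul_nonsing_inv _ (isUnit_iff_ne_zero.2 hH),
        Matrix.one_mulVec]
    have hp : (∑ i, C (c i) * X i : MvPolynomial σ K).IsHomogeneous 1 :=
      IsHomogeneous.sum _ _ _ fun i _ => (isHomogeneous_X K i).C_mul _
    refine ⟨_, ⟨∑ i, C (c i) * X i, hp, rfl⟩, ?_⟩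
    have hzero : diffOp K σ ((∑ i, X i) ^ (r - 2) * (∑ i, C (c i) * X i) - Q) F = 0 := by
      refine eq_zero_of_pderiv_eq_zero ?_ fun i => ?_
      · convert isHomogeneous_diffOp (IsHomogeneous.sub (hprod _ hp) hQ) hF using 1
        lia
      · rw [map_sub, LinearMap.sub_apply, map_sub, pderiv_diffOp_sum_X_pow_mul hF, hl', hc,
          Pi.smul_apply, smul_eq_mul, mul_inv_cancel_left₀ hfac, sub_self]
    have := Ideal.Quotient.eq.2 ((hmem _).2 hzero)
    simpa using this

end DiffOp

/-! ### The basis generating function of a simple matroid -/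

section BasisGenFun

theorem eval_pderiv_prod_X {K : Type*} [Field K] {σ : Type*} [DecidableEq σ] (B : Finset σ)
    (i j : σ) : eval (1 : σ → K) (pderiv i (pderiv j (∏ e ∈ B, X e : MvPolynomial σ K))) =
      if i ∈ B ∧ j ∈ B ∧ i ≠ j then 1 else 0 := by
  have key : ∀ (B : Finset σ) (j : σ), pderiv j (∏ e ∈ B, X e : MvPolynomial σ K) =
      if j ∈ B then ∏ e ∈ B.erase j, X e else 0 := by
    intro B j
    induction B using Finset.induction_on with
    | empty => simp
    | insert a B ha ih =>
      rw [Finset.prod_insert ha, Derivation.leibniz, ih]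
      by_cases hja : j = a
      · subst hja
        simp [ha]
      · by_cases hj : j ∈ B
        · rw [if_pos hj, pderiv_X_of_ne (Ne.symm hja), if_pos (Finset.mem_insert_of_mem hj),
            Finset.erase_insert_of_ne (Ne.symm hja), Finset.prod_insert (by simp [ha])]
          simp
        · simp [hj, hja, pderiv_X_of_ne (Ne.symm hja)]
  rw [key]
  by_cases hj : j ∈ B
  · rw [if_pos hj, key]
    by_cases hi : i ∈ B <;> by_cases hij : i = j <;> simp [hi, hj, hij]
  · simp [hj]

variable {K : Type*} [Field K] {α : Type*} {M : Matroid α} [M.Finite] [Fintype M.E]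

open Classical in
-- Passing to `restrictSubtype` makes the ground set the whole type, as the basis-count results
-- require.
theorem basisGenFun_eq_sum : basisGenFun K M =
    ∑ B ∈ (Finset.univ : Finset (Finset M.E)).filter
      (fun B : Finset M.E => (M.restrictSubtype M.E).IsBase (B : Set M.E)), ∏ e ∈ B, X e := by
  rw [basisGenFun, finsum_eq_sum_of_fintype]
  refine (Finset.sum_subtype _ (fun B => ?_)
    (fun B : Finset M.E => (∏ e ∈ B, X e : MvPolynomial M.E K))).symm
  simp

theorem isHomogeneous_basisGenFun {r : ℕ}
    (hr : ∀ B : Finset M.E, (M.restrictSubtype M.E).IsBase (B : Set M.E) → B.card = r) :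
    (basisGenFun K M).IsHomogeneous r := by
  classical
  rw [basisGenFun_eq_sum]
  refine IsHomogeneous.sum _ _ _ fun B hB => ?_
  have := IsHomogeneous.prod B (fun e => (X e : MvPolynomial M.E K)) (fun _ => 1)
    fun e _ => isHomogeneous_X K e
  simpa [hr B (Finset.mem_filter.1 hB).2] using this

theorem hessianAtOne_basisGenFun : hessianAtOne (basisGenFun K M) =
    (basisCount (M.restrictSubtype M.E) ∅).map (Nat.cast : ℕ → K) := by
  classical
  ext i j
  simp only [hessianAtOne, Matrix.of_apply, Matrix.map_apply, basisGenFun_eq_sum, map_sum,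
    eval_pderiv_prod_X, basisCount]
  rw [Finset.sum_boole, Finset.filter_filter]
  congr 2
  ext B
  simp

/-- The strong Lefschetz property in degree one for simple matroids. -/
theorem MatroidAlgebra.bijOn_sumVars_pow_mul [CharZero K] {r : ℕ} (hr2 : 2 ≤ r)
    (hr : ∀ B, M.IsBase B → B.ncard = r) (hsimple : ∀ e ∈ M.E, ∀ f ∈ M.E, M.Indep {e, f}) :
    Set.BijOn (fun a : MatroidAlgebra K M => MatroidAlgebra.sumVars K M ^ (r - 2) * a)
      (MatroidAlgebra.component K M 1) (MatroidAlgebra.component K M (r - 1)) := by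
  classical
  have hr' : ∀ B : Finset M.E, (M.restrictSubtype M.E).IsBase (B : Set M.E) → B.card = r := by
    intro B hB
    rw [Matroid.restrictSubtype_ground_isBase_iff] at hB
    rw [← hr _ hB, Set.ncard_image_of_injective _ Subtype.val_injective, Set.ncard_coe_finset]
  have hdet : (hessianAtOne (basisGenFun K M)).det ≠ 0 := by
    rw [hessianAtOne_basisGenFun]
    refine basisCount_det_ne_zero K Matroid.restrictSubtype_ground hr2 hr' fun i j => ?_
    rw [Matroid.restrictSubtype_indep_iff]
    simpa [Set.image_pair] using hsimple i i.2 j j.2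
  have := bijOn_sum_X_pow_mul hr2 (isHomogeneous_basisGenFun hr') hdet
  rwa [← finsum_eq_sum_of_fintype] at this

end BasisGenFun

/-! ### Truncated graphic matroids of complete graphs -/

section TruncatedComplete

theorem truncatedComplete_indep_iff {n r : ℕ} {I : Set (Sym2 (Fin n))} :
    (truncatedComplete n r).Indep I ↔
      (I ⊆ (⊤ : SimpleGraph (Fin n)).edgeSet ∧ (SimpleGraph.fromEdgeSet I).IsAcyclic) ∧
        I.encard ≤ r := by
  simp [truncatedComplete, truncatedMatroid, graphicMatroid]

/-- A spanning tree has `n - 1 ≥ r` edges, so some forest has exactly `r` edges and the truncation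
attains rank `r`. -/
theorem ncard_of_isBase_truncatedComplete {n r : ℕ} (hrn : r < n) {B : Set (Sym2 (Fin n))}
    (hB : (truncatedComplete n r).IsBase B) : B.ncard = r := by
  classical
  have : Nonempty (Fin n) := ⟨⟨0, by lia⟩⟩
  obtain ⟨T, hTle, hT⟩ := (SimpleGraph.connected_top (V := Fin n)).exists_isTree_le
  have hcard : T.edgeSet.ncard + 1 = n := by
    have := hT.card_edgeFinset
    simp only [Fintype.card_fin, SimpleGraph.edgeFinset] at this
    rwa [Set.ncard_eq_toFinset_card']
  obtain ⟨I, hIT, hI⟩ := Set.exists_subset_card_eq (s := T.edgeSet) (n := r) (by lia)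
  have hIe : I.encard = r := by
    rw [← hI, (Set.toFinite I).cast_ncard_eq]
  have hIind : (truncatedComplete n r).Indep I := by
    refine truncatedComplete_indep_iff.2 ⟨⟨hIT.trans (SimpleGraph.edgeSet_mono hTle), ?_⟩, hIe.le⟩
    refine hT.isAcyclic.anti ?_
    rw [← T.fromEdgeSet_edgeSet]
    exact SimpleGraph.fromEdgeSet_mono hIT
  obtain ⟨B', hB', hIB'⟩ := hIind.exists_isBase_superset
  have h1 : (r : ℕ∞) ≤ B.encard := by
    rw [hB.encard_eq_encard_of_isBase hB', ← hIe]
    exact Set.encard_le_encard hIB'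
  have h2 := le_antisymm (truncatedComplete_indep_iff.1 hB.indep).2 h1
  rw [Set.ncard, h2, ENat.toNat_natCast]

/-- A cycle in a simple graph needs at least three distinct edges. -/
theorem isAcyclic_fromEdgeSet_pair {V : Type*} [Finite V] (e f : Sym2 V) :
    (SimpleGraph.fromEdgeSet {e, f}).IsAcyclic := by
  classical
  have := Fintype.ofFinite V
  intro v c hc
  have h1 := hc.three_le_length
  have h2 := hc.isTrail.length_le_card_edgeFinset
  have h3 : (SimpleGraph.fromEdgeSet {e, f}).edgeFinset ⊆ {e, f} := by
    intro x hx
    rw [SimpleGraph.mem_edgeFinset, SimpleGraph.edgeSet_fromEdgeSet] at hx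
    simpa using hx.1
  have h4 := (Finset.card_le_card h3).trans Finset.card_le_two
  lia

theorem truncatedComplete_indep_pair {n r : ℕ} (hr : 2 ≤ r) {e f : Sym2 (Fin n)}
    (he : e ∈ (truncatedComplete n r).E) (hf : f ∈ (truncatedComplete n r).E) :
    (truncatedComplete n r).Indep {e, f} := by
  refine truncatedComplete_indep_iff.2 ⟨⟨?_, isAcyclic_fromEdgeSet_pair e f⟩, ?_⟩
  · exact Set.insert_subset he (Set.singleton_subset_iff.2 hf)
  · calc ({e, f} : Set (Sym2 (Fin n))).encard ≤ ({f} : Set (Sym2 (Fin n))).encard + 1 :=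
          Set.encard_insert_le _ _
      _ = 2 := by rw [Set.encard_singleton, one_add_one_eq_two]
      _ ≤ r := by exact_mod_cast hr

end TruncatedComplete

theorem mainTheorem5 (K : Type*) [Field K] [CharZero K] (n r : ℕ) (hr : 2 < r) (hrn : r < n) :
    Set.BijOn
      (fun a : MatroidAlgebra K (truncatedComplete n r) =>
        MatroidAlgebra.sumVars K (truncatedComplete n r) ^ (r - 2) * a)
      (MatroidAlgebra.component K (truncatedComplete n r) 1)
      (MatroidAlgebra.component K (truncatedComplete n r) (r - 1)) := by
  classical
  have : Fintype (truncatedComplete n r).E := Fintype.ofFinite _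
  exact MatroidAlgebra.bijOn_sumVars_pow_mul hr.le
    (fun B hB => ncard_of_isBase_truncatedComplete hrn hB)
    (fun e he f hf => truncatedComplete_indep_pair hr.le he hf)
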